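/- Call a Hausdorff space strongly anti-Urysohn (SAU) if it has at least two non-isolated points and any two infinite closed subsets of it intersect. For a topological space $X$ let $X_r$ denote the set $X$ with the topology generated by the regular open subsets of $X$, i.e. the sets $U$ with $U=\operatorname{Int}\overline U$. Let $\Delta(Y)=\min\{|U| : U \text{ a non-empty open subset of } Y\}$. The following holds in ZFC. (1) There is a separable, scattered SAU space $X$ of cardinality $2^{\mathfrak c}$ (Juhász–Shelah–Soukup–Szentmiklóssy). (2) For every separable SAU space $X$ of cardinality $2^{\mathfrak c}$ (in particular for the space in (1)), the space $X_r$ has a closed subspace $Y$ which is again SAU and satisfies $\Delta(Y)=2^{\mathfrak c}$, i.e. every non-empty open set in $Y$ has cardinality $2^{\mathfrak c}$. In particular, $Y$ is crowded (it has no isolated points). Consequently, crowded SAU spaces exist in ZFC. -/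

import Mathlib

universe u

open Cardinal Topology

/-- A strongly anti-Urysohn (SAU) space: a Hausdorff space with at least two non-isolated points
in which any two infinite closed sets intersect. -/
structure IsSAU (X : Type u) [TopologicalSpace X] : Prop where
  t2 : T2Space X
  exists_nonisolated : ∃ x y : X, x ≠ y ∧ ¬ IsOpen ({x} : Set X) ∧ ¬ IsOpen ({y} : Set X)
  inter_nonempty : ∀ F G : Set X, IsClosed F → IsClosed G → F.Infinite → G.Infinite →
    (F ∩ G).Nonempty

/-- A space is scattered (equivalently, right-separated) if every non-empty subspace has an
isolated point. -/
def IsScatteredSpace (X : Type u) [TopologicalSpace X] : Prop :=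
  ∀ A : Set X, A.Nonempty → ∃ x ∈ A, ∃ U : Set X, IsOpen U ∧ U ∩ A = {x}

/-- A set is regular open if it is the interior of its closure. -/
def IsRegularOpenSet {X : Type u} [TopologicalSpace X] (U : Set X) : Prop :=
  interior (closure U) = U

/-- The space `X_r`: the set `X` with the topology generated by the regular open subsets
of `X`. -/
def RegularOpenCoarsening (X : Type u) : Type u := X

instance instTopologicalSpaceRegularOpenCoarsening (X : Type u) [TopologicalSpace X] :
    TopologicalSpace (RegularOpenCoarsening X) :=
  TopologicalSpace.generateFrom {U : Set X | IsRegularOpenSet U}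

/-- The dispersion character `Δ(Y)`: the least cardinality of a non-empty open subset of `Y`. -/
noncomputable def dispersionCharacter (Y : Type u) [TopologicalSpace Y] : Cardinal.{u} :=
  sInf {κ : Cardinal.{u} | ∃ U : Set Y, IsOpen U ∧ U.Nonempty ∧ κ = #U}

/-! For (1), a weak P-point with uncountably many linked refinements for each sequence of its
members is built from Kunen's independent linked family. Half of the rows code a subset of `Set ℕ`,
giving `2 ^ 𝔠` such ultrafilters. An isomorphism class has at most `𝔠` members, so `2 ^ 𝔠` of them
are pairwise non-isomorphic. The space consists of well-founded trees. A node is made the limit of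
two injective sequences of trees, each along its own weak P-point. Any two infinite closed sets
contain such sequences, and a node joining them lies in both sets (`SeqTree.isSAU`). Non-isomorphic
weak P-points allow countably many sequences to be thinned to pairwise disjoint ones, which gives
Hausdorffness (`SeqTree.t2Space`). For (2), separability leaves at most `𝔠` regular open sets, and
`2 ^ 𝔠` has cofinality above `𝔠`. Hence the regular open sets of size below `2 ^ 𝔠` have a union of
size below `2 ^ 𝔠`, and `Y` is its complement. Closed subsets of `Y` are closed in `X`, so `Y`
inherits the intersection property. -/

open Filter Set

/-! ### Kunen's independent linked family -/

/-- The trace of a set of natural numbers on an initial segment. -/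
def initialTrace (k : ℕ) (X : Set ℕ) : Set (Fin k) := {i | (i : ℕ) ∈ X}

theorem eventually_injOn_initialTrace (s : Finset (Set ℕ)) :
    ∀ᶠ k in atTop, Set.InjOn (initialTrace k) (s : Set (Set ℕ)) := by
  have h : ∀ᶠ k in atTop, ∀ X ∈ s, ∀ Y ∈ s, initialTrace k X = initialTrace k Y → X = Y := by
    rw [eventually_all_finset]
    intro X _
    rw [eventually_all_finset]
    intro Y _
    by_cases hXY : X = Y
    · exact Eventually.of_forall fun _ _ => hXY
    · obtain ⟨m, hm⟩ : ∃ m, ¬ (m ∈ X ↔ m ∈ Y) := by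
        by_contra! hc
        exact hXY (Set.ext hc)
      filter_upwards [eventually_gt_atTop m] with k hk he
      exact absurd (Set.ext_iff.1 he ⟨m, hk⟩) hm
  filter_upwards [h] with k hk X hX Y hY hXY
  exact hk X hX Y hY hXY

/-- The countable set carrying Kunen's independent linked family. -/
abbrev KunenIndex : Type := Σ k : ℕ, (Set (Fin k) → Finset (Set (Fin k)))

open Classical in
/-- Kunen's independent linked family. -/
def kunenSet (X Y : Set ℕ) (n : ℕ) : Set KunenIndex :=
  {a | (a.2 (initialTrace a.1 X)).card ≤ n ∧ initialTrace a.1 Y ∈ a.2 (initialTrace a.1 X)}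

theorem kunenSet_mono (X Y : Set ℕ) : Monotone (kunenSet X Y) :=
  fun _ _ h _ ha => ⟨ha.1.trans h, ha.2⟩

theorem finite_sigma_lt (k₀ : ℕ) : {a : KunenIndex | a.1 < k₀}.Finite := by
  have : {a : KunenIndex | a.1 < k₀} = ⋃ k ∈ Set.Iio k₀, Set.range (Sigma.mk k) := by
    ext ⟨k, f⟩
    simp only [Set.mem_ofPred_eq, Set.mem_iUnion, Set.mem_range, Set.mem_Iio, exists_prop]
    constructor
    · intro h
      exact ⟨k, h, f, rfl⟩
    · rintro ⟨k', h, g, hg⟩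
      cases hg
      exact h
  rw [this]
  exact (Set.finite_Iio k₀).biUnion fun k _ => Set.finite_range _

/-- Once `k` separates the members of `T`, their traces are more than `n` elements of one value of
`a.2`, against its size bound `n`. -/
theorem kunenSet_linked (X : Set ℕ) (T : Finset (Set ℕ)) (n : ℕ) (h : n < T.card) :
    {a | ∀ Y ∈ T, a ∈ kunenSet X Y n}.Finite := by
  classical
  obtain ⟨k₀, hk₀⟩ := eventually_atTop.1 (eventually_injOn_initialTrace T)
  refine (finite_sigma_lt k₀).subset fun a ha => ?_
  by_contra hlt
  have hinj := hk₀ a.1 (not_lt.1 hlt)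
  obtain ⟨Y₀, hY₀⟩ : T.Nonempty := Finset.card_pos.1 (by omega)
  have h1 : (T.image (initialTrace a.1)).card ≤ (a.2 (initialTrace a.1 X)).card := by
    refine Finset.card_le_card fun Z hZ => ?_
    obtain ⟨Y, hY, rfl⟩ := Finset.mem_image.1 hZ
    exact (ha Y hY).2
  rw [Finset.card_image_of_injOn hinj] at h1
  have := (ha Y₀ hY₀).1
  omega

theorem kunenSet_independent (s : Finset (Set ℕ)) (c : Set ℕ → Finset (Set ℕ)) :
    {a | ∀ X ∈ s, ∀ Y ∈ c X, a ∈ kunenSet X Y (c X).card}.Infinite := by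
  classical
  obtain ⟨k₀, hk₀⟩ := eventually_atTop.1 (eventually_injOn_initialTrace s)
  -- The value at the trace of `X` is to be the set of traces of `c X`. For large `k` distinct
  -- members of `s` have distinct traces, so the union has a single term.
  let f : ∀ k, Set (Fin k) → Finset (Set (Fin k)) := fun k X' =>
    (s.filter fun X => initialTrace k X = X').biUnion fun X => (c X).image (initialTrace k)
  have hf : ∀ k, k₀ ≤ k → ∀ X ∈ s,
      f k (initialTrace k X) = (c X).image (initialTrace k) := by
    intro k hk X hX
    have : (s.filter fun X₁ => initialTrace k X₁ = initialTrace k X) = {X} := by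
      ext X₁
      simp only [Finset.mem_filter, Finset.mem_singleton]
      constructor
      · rintro ⟨h1, h2⟩
        exact hk₀ k hk h1 hX h2
      · rintro rfl
        exact ⟨hX, rfl⟩
    simp only [f, this, Finset.singleton_biUnion]
  have hinj : Set.InjOn (fun k => (⟨k, f k⟩ : KunenIndex)) (Set.Ici k₀) := by
    intro k _ k' _ h
    exact congrArg Sigma.fst h
  refine ((Set.Ici_infinite k₀).image hinj).mono ?_
  rintro _ ⟨k, hk, rfl⟩ X hX Y hY
  refine ⟨?_, ?_⟩
  · change (f k (initialTrace k X)).card ≤ _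
    rw [hf k hk X hX]
    exact Finset.card_image_le
  · change initialTrace k Y ∈ f k (initialTrace k X)
    rw [hf k hk X hX]
    exact Finset.mem_image_of_mem _ hY

/-- A matrix of subsets of `ℕ` which is an independent linked family: each row `α` consists of
increasing sequences `A α β`, the sets `A α β n` of level `n` have finite `(n + 1)`-fold
intersections, while finitely many `n`-fold intersections of level `n` from different rows always
meet in an infinite set. -/
structure IndependentLinkedFamily (ι κ : Type*) where
  A : ι → κ → ℕ → Set ℕ
  mono : ∀ α β, Monotone (A α β)
  linked : ∀ α (T : Finset κ) n, n < T.card → {i | ∀ β ∈ T, i ∈ A α β n}.Finite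
  independent : ∀ (s : Finset ι) (c : ι → Finset κ),
    {i | ∀ α ∈ s, ∀ β ∈ c α, i ∈ A α β (c α).card}.Infinite

theorem exists_independentLinkedFamily {ι : Type*} (e : ι ↪ Set ℕ) :
    Nonempty (IndependentLinkedFamily ι (Set ℕ)) := by
  classical
  have : Infinite KunenIndex :=
    Infinite.of_injective (fun k => (⟨k, fun _ => ∅⟩ : KunenIndex))
      fun k k' h => congrArg Sigma.fst h
  have : Countable KunenIndex := inferInstance
  obtain ⟨g⟩ : Nonempty (ℕ ≃ KunenIndex) := by
    obtain ⟨d⟩ := nonempty_denumerable KunenIndex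
    exact ⟨(Denumerable.eqv KunenIndex).symm⟩
  refine ⟨⟨fun α β n => g ⁻¹' kunenSet (e α) β n, ?_, ?_, ?_⟩⟩
  · intro α β m n h
    exact Set.preimage_mono (kunenSet_mono _ _ h)
  · intro α T n h
    exact (kunenSet_linked (e α) T n h).preimage g.injective.injOn
  · intro s c
    by_cases hι : Nonempty ι
    · have := kunenSet_independent (s.map e) (fun X => c (Function.invFun e X))
      have h2 := this.preimage (f := g) (by rw [g.range_eq_univ]; exact Set.subset_univ _)
      refine h2.mono fun i hi α hα β hβ => ?_
      have h3 := hi (e α) (Finset.mem_map_of_mem e hα) β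
      simp only [Function.leftInverse_invFun e.injective α] at h3
      exact h3 hβ
    · have : s = ∅ := Finset.eq_empty_of_forall_notMem fun α _ => hι ⟨α⟩
      subst this
      simpa using Set.infinite_univ

/-! ### Linked refinements: settling one sequence -/

namespace IndependentLinkedFamily

variable {ι κ : Type*} (M : IndependentLinkedFamily ι κ)

/-- The intersection of one block from each of the rows in `s`. -/
def block (s : Finset ι) (c : ι → Finset κ) : Set ℕ :=
  {i | ∀ α ∈ s, ∀ β ∈ c α, i ∈ M.A α β (c α).card}

/-- The rows in `R` are independent modulo the filter `F`. -/
def IndepMod (F : Filter ℕ) (R : Set ι) : Prop :=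
  ∀ (s : Finset ι) (c : ι → Finset κ), (s : Set ι) ⊆ R → (F ⊓ 𝓟 (M.block s c)).NeBot

/-- `V` is a linked refinement of the sequence `U`. -/
def LinkedRefines (V : κ → Set ℕ) (U : ℕ → Set ℕ) : Prop :=
  ∀ (n : ℕ) (T : Finset κ), n < T.card → ∀ᶠ i in cofinite, (∀ β ∈ T, i ∈ V β) → i ∈ U n

/-- Every ultrafilter below `F` containing all `U n` has a linked refinement of `U`. -/
def Settles (κ : Type*) (F : Filter ℕ) (U : ℕ → Set ℕ) : Prop :=
  ∀ p : Ultrafilter ℕ, ↑p ≤ F → (∀ n, U n ∈ p) →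
    ∃ V : κ → Set ℕ, (∀ β, V β ∈ p) ∧ LinkedRefines V U

theorem block_union [DecidableEq ι] {s t : Finset ι} (h : Disjoint s t) (c d : ι → Finset κ) :
    M.block (s ∪ t) (fun α => if α ∈ s then c α else d α) = M.block s c ∩ M.block t d := by
  ext i
  constructor
  · intro hi
    refine ⟨fun α hα => ?_, fun α hα => ?_⟩
    · have := hi α (Finset.mem_union_left _ hα)
      simpa only [if_pos hα] using this
    · have := hi α (Finset.mem_union_right _ hα)
      simpa only [if_neg (Finset.disjoint_right.1 h hα)] using this
  · rintro ⟨h1, h2⟩ α hα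
    by_cases hs : α ∈ s
    · simpa only [if_pos hs] using h1 α hs
    · simpa only [if_neg hs] using h2 α ((Finset.mem_union.1 hα).resolve_left hs)

/-- Either every `W n` is compatible with `F` and all blocks, and one row `α` is spent on building a
refinement; or some `W n` is not, and adding the offending block to `F` makes the claim vacuous. -/
theorem exists_settles {F : Filter ℕ} (hF : F ≤ cofinite) {R : Set ι} (hR : M.IndepMod F R)
    (hne : R.Nonempty) (U : ℕ → Set ℕ) :
    ∃ (F' : Filter ℕ) (r : Finset ι), F' ≤ F ∧ M.IndepMod F' (R \ r) ∧ Settles κ F' U := by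
  classical
  obtain ⟨α, hα⟩ := hne
  let W : ℕ → Set ℕ := fun n => {i | n ≤ i ∧ ∀ j < n, i ∈ U j}
  by_cases hcase : ∀ (n : ℕ) (s : Finset ι) (c : ι → Finset κ), (s : Set ι) ⊆ R →
      (F ⊓ 𝓟 (W n ∩ M.block s c)).NeBot
  -- `V β` uses at each point `i` the highest level that the sets `U j` permit there; the bound `i`
  -- keeps this level finite.
  · let ν : ℕ → ℕ := fun i => Nat.findGreatest (fun n => ∀ j < n, i ∈ U j) i
    have hν : ∀ i, ∀ j < ν i, i ∈ U j := fun i =>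
      Nat.findGreatest_spec (P := fun n => ∀ j < n, i ∈ U j) (Nat.zero_le i)
        (fun j hj => absurd hj (Nat.not_lt_zero j))
    let V : κ → Set ℕ := fun β => {i | i ∈ M.A α β (ν i)}
    refine ⟨⨅ T : Finset κ, F ⊓ 𝓟 {i | ∀ β ∈ T, i ∈ V β}, {α}, ?_, ?_, ?_⟩
    · exact (iInf_le _ ∅).trans inf_le_left
    · intro s c hs
      rw [iInf_inf]
      have hdir : Directed (· ≥ ·) fun T : Finset κ =>
          F ⊓ 𝓟 {i | ∀ β ∈ T, i ∈ V β} ⊓ 𝓟 (M.block s c) := by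
        refine directed_of_isDirected_le fun T T' h => ?_
        refine inf_le_inf_right _ (inf_le_inf_left _ (principal_mono.2 ?_))
        exact fun i hi β hβ => hi β (h hβ)
      rw [iInf_neBot_iff_of_directed hdir]
      intro T
      have hd : Disjoint ({α} : Finset ι) s := by
        rw [Finset.disjoint_singleton_left]
        intro h
        exact (hs h).2 (by simp)
      refine (hcase T.card ({α} ∪ s) (fun a => if a ∈ ({α} : Finset ι) then T else c a) ?_).mono ?_
      · intro a ha
        rcases Finset.mem_union.1 ha with h | h
        · rw [Finset.mem_singleton.1 h]
          exact hα
        · exact (hs h).1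
      · rw [M.block_union hd (fun _ => T) c, inf_assoc, inf_principal]
        refine inf_le_inf_left _ (principal_mono.2 ?_)
        rintro i ⟨⟨h1, h2⟩, h3, h4⟩
        refine ⟨fun β hβ => ?_, h4⟩
        exact M.mono α β (Nat.le_findGreatest h1 h2) (h3 α (Finset.mem_singleton_self α) β hβ)
    · intro p hp _
      refine ⟨V, fun β => ?_, fun n T hT => ?_⟩
      · have : {i | ∀ β' ∈ ({β} : Finset κ), i ∈ V β'} ∈ (p : Filter ℕ) :=
          hp (mem_iInf_of_mem {β} (mem_inf_of_right (mem_principal_self _)))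
        exact mem_of_superset this fun i hi => hi β (Finset.mem_singleton_self β)
      -- More than `n` of the sets `V β` can meet only finitely often where `ν i ≤ n`; elsewhere `n
      -- < ν i` forces `i ∈ U n`.
      · have hfin : (⋃ m ∈ Set.Iic n, {i | ∀ β ∈ T, i ∈ M.A α β m}).Finite :=
          (Set.finite_Iic n).biUnion fun m hm => M.linked α T m (lt_of_le_of_lt hm hT)
        filter_upwards [hfin.compl_mem_cofinite] with i hi hV
        refine hν i n (not_le.1 fun hle => hi ?_)
        exact Set.mem_biUnion (show ν i ∈ Set.Iic n from hle) fun β hβ => hV β hβ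
  · push Not at hcase
    obtain ⟨n, s, c, hs, hbot⟩ := hcase
    refine ⟨F ⊓ 𝓟 (M.block s c), s, inf_le_left, ?_, ?_⟩
    · intro t d ht
      have hd : Disjoint s t := Finset.disjoint_right.2 fun a ha has => (ht ha).2 has
      rw [inf_assoc, inf_principal, ← M.block_union hd]
      refine hR _ _ fun a ha => ?_
      rcases Finset.mem_union.1 ha with h | h
      · exact hs h
      · exact (ht h).1
    · intro p hp hU
      exfalso
      have hW : W n ∈ (p : Filter ℕ) := by
        have h1 : ∀ᶠ i in (p : Filter ℕ), n ≤ i := by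
          have : ∀ᶠ i in cofinite, n ≤ i := by
            rw [Nat.cofinite_eq_atTop]
            exact eventually_ge_atTop n
          exact (hp.trans (inf_le_left.trans hF)) this
        have h2 : ∀ᶠ i in (p : Filter ℕ), ∀ j ∈ Set.Iio n, i ∈ U j :=
          (eventually_all_finite (Set.finite_Iio n)).2 fun j _ => hU j
        filter_upwards [h1, h2] with i hi1 hi2
        exact ⟨hi1, hi2⟩
      have h3 : (p : Filter ℕ) ≤ F ⊓ 𝓟 (W n ∩ M.block s c) := by
        refine le_inf (hp.trans inf_le_left) (le_principal_iff.2 (inter_mem hW ?_))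
        exact le_principal_iff.1 (hp.trans inf_le_right)
      rw [hbot] at h3
      exact p.neBot.ne (le_bot_iff.1 h3)

end IndependentLinkedFamily

/-! ### Transfinite recursion settling all sequences -/

namespace IndependentLinkedFamily

theorem Settles.anti {κ : Type*} {F F' : Filter ℕ} {U : ℕ → Set ℕ} (h : Settles κ F U)
    (hF : F' ≤ F) : Settles κ F' U :=
  fun p hp hU => h p (hp.trans hF) hU

variable {ι κ : Type} (M : IndependentLinkedFamily ι κ)

open Classical in
/-- One step of the recursion: a pair of a smaller filter and a finite set of discarded rows which
settles `U`, whenever there is one. -/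
noncomputable def settleStep (F : Filter ℕ) (R : Set ι) (U : ℕ → Set ℕ) : Filter ℕ × Finset ι :=
  if h : ∃ q : Filter ℕ × Finset ι, q.1 ≤ F ∧ M.IndepMod q.1 (R \ q.2) ∧ Settles κ q.1 U then
    h.choose
  else (F, ∅)

theorem settleStep_spec {F : Filter ℕ} (hF : F ≤ cofinite) {R : Set ι} (hR : M.IndepMod F R)
    (hne : R.Nonempty) (U : ℕ → Set ℕ) :
    (M.settleStep F R U).1 ≤ F ∧ M.IndepMod (M.settleStep F R U).1 (R \ (M.settleStep F R U).2) ∧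
      Settles κ (M.settleStep F R U).1 U := by
  have h : ∃ q : Filter ℕ × Finset ι, q.1 ≤ F ∧ M.IndepMod q.1 (R \ q.2) ∧ Settles κ q.1 U := by
    obtain ⟨F', r, h⟩ := M.exists_settles hF hR hne U
    exact ⟨(F', r), h⟩
  rw [settleStep, dif_pos h]
  exact h.choose_spec

/-- An independent family of rows modulo `F₀` of size continuum allows one to settle all sequences
of sets. -/
theorem exists_forall_settles {F₀ : Filter ℕ} (hF₀ : F₀ ≤ cofinite) {R₀ : Set ι}
    (hR₀ : M.IndepMod F₀ R₀) (hcard : 𝔠 ≤ #R₀) :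
    ∃ F ≤ F₀, F.NeBot ∧ ∀ U : ℕ → Set ℕ, Settles κ F U := by
  classical
  let O : Type := (𝔠 : Cardinal.{0}).ord.ToType
  have hO : #O = 𝔠 := by simp [O]
  obtain ⟨e⟩ : Nonempty (O ≃ (ℕ → Set ℕ)) := by
    rw [← Cardinal.eq, hO]
    simp
  let G : O → Filter ℕ × Finset ι := IsWellFounded.fix (α := O) (· < ·) fun μ g =>
    M.settleStep (F₀ ⊓ ⨅ ν : Iio μ, (g ν.1 ν.2).1) (R₀ \ ⋃ ν : Iio μ, (g ν.1 ν.2).2) (e μ)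
  let pF : O → Filter ℕ := fun μ => F₀ ⊓ ⨅ ν : Iio μ, (G ν).1
  let pR : O → Set ι := fun μ => R₀ \ ⋃ ν : Iio μ, ((G ν).2 : Set ι)
  have hG : ∀ μ, G μ = M.settleStep (pF μ) (pR μ) (e μ) := fun μ =>
    IsWellFounded.fix_eq (α := O) (· < ·) _ μ
  have key : ∀ μ, (G μ).1 ≤ pF μ ∧ M.IndepMod (G μ).1 (pR μ \ (G μ).2) ∧
      Settles κ (G μ).1 (e μ) := by
    intro μ
    induction μ using WellFoundedLT.induction with
    | ind μ ih =>
    rw [hG μ]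
    refine M.settleStep_spec (inf_le_left.trans hF₀) ?_ ?_ (e μ)
    · intro s c hs
      change (pF μ ⊓ 𝓟 (M.block s c)).NeBot
      by_cases hemp : Nonempty (Iio μ)
      · have h1 : pF μ = ⨅ ν : Iio μ, (G ν).1 := by
          refine inf_eq_right.2 ?_
          obtain ⟨ν⟩ := hemp
          exact (iInf_le _ ν).trans ((ih ν ν.2).1.trans inf_le_left)
        rw [h1, iInf_inf]
        have hdir : Directed (· ≥ ·) fun ν : Iio μ => (G ν).1 ⊓ 𝓟 (M.block s c) := by
          refine directed_of_isDirected_le fun ν ν' h => inf_le_inf_right _ ?_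
          rcases h.eq_or_lt with rfl | h
          · exact le_rfl
          · exact (ih ν' ν'.2).1.trans (inf_le_right.trans (iInf_le _ (⟨ν.1, h⟩ : Iio ν'.1)))
        rw [iInf_neBot_iff_of_directed hdir]
        intro ν
        refine (ih ν ν.2).2.1 s c fun a ha => ⟨⟨(hs ha).1, fun h => ?_⟩, fun h => ?_⟩
        · obtain ⟨ξ, hξ⟩ := Set.mem_iUnion.1 h
          exact (hs ha).2 (Set.mem_iUnion.2 ⟨⟨ξ, lt_trans (show ξ.1 < ν.1 from ξ.2) ν.2⟩, hξ⟩)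
        · exact (hs ha).2 (Set.mem_iUnion.2 ⟨ν, h⟩)
      · rw [not_nonempty_iff] at hemp
        have h1 : pF μ = F₀ := by simp [pF, iInf_of_empty]
        rw [h1]
        exact hR₀ s c fun a ha => (hs ha).1
    -- A row is still available: fewer than `𝔠` stages have each discarded finitely many rows.
    · rw [Set.nonempty_iff_ne_empty]
      intro he
      have hsub : R₀ ⊆ ⋃ ν : Iio μ, ((G ν).2 : Set ι) := Set.sdiff_eq_empty.1 he
      have h1 : #(⋃ ν : Iio μ, ((G ν).2 : Set ι)) ≤ #(Iio μ) * ℵ₀ := by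
        refine (mk_iUnion_le _).trans ?_
        gcongr
        exact ciSup_le' fun ν => ((G ν).2.finite_toSet.lt_aleph0).le
      have h2 : #(Iio μ) < 𝔠 := by
        simpa [O] using mk_Iio_lt μ
      have h3 : #(Iio μ) * ℵ₀ < 𝔠 := mul_lt_of_lt aleph0_le_continuum h2 aleph0_lt_continuum
      exact (hcard.trans ((mk_le_mk_of_subset hsub).trans h1)).not_gt h3
  have hne : Nonempty O := by
    rw [← mk_ne_zero_iff, hO]
    exact continuum_ne_zero
  refine ⟨⨅ μ, (G μ).1, ?_, ?_, fun U => ?_⟩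
  · obtain ⟨μ⟩ := hne
    exact (iInf_le _ μ).trans ((key μ).1.trans inf_le_left)
  · have hdir : Directed (· ≥ ·) fun μ : O => (G μ).1 := by
      refine directed_of_isDirected_le fun ν μ h => ?_
      rcases h.eq_or_lt with rfl | h
      · exact le_rfl
      · exact (key μ).1.trans (inf_le_right.trans (iInf_le _ (⟨ν, h⟩ : Iio μ)))
    rw [iInf_neBot_iff_of_directed hdir]
    intro μ
    exact ((key μ).2.1 ∅ (fun _ => ∅) (by simp)).mono inf_le_left
  · obtain ⟨μ, rfl⟩ := e.surjective U
    exact (key μ).2.2.anti (iInf_le _ μ)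

end IndependentLinkedFamily

/-! ### Weak P-points -/

/-- A weak P-point of `ℕ*`: a free ultrafilter which is not in the closure of any countable set
of other free ultrafilters. -/
structure IsWeakPPoint (p : Ultrafilter ℕ) : Prop where
  free : (p : Filter ℕ) ≤ cofinite
  exists_notMem : ∀ {ι : Type u} [Countable ι] (q : ι → Ultrafilter ℕ),
    (∀ j, q j ≠ p) → (∀ j, (q j : Filter ℕ) ≤ cofinite) → ∃ I ∈ p, ∀ j, I ∉ q j

-- Choose `U n` in `p` outside the `n`-th ultrafilter. If each of the uncountably many `V β`
-- belonged to some member of the sequence, one member would contain `n + 1` of them, hence also `U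
-- n`.
open IndependentLinkedFamily in
theorem isWeakPPoint_of_linkedRefines {κ : Type*} [Uncountable κ] {p : Ultrafilter ℕ}
    (hfree : (p : Filter ℕ) ≤ cofinite)
    (h : ∀ U : ℕ → Set ℕ, (∀ n, U n ∈ p) →
      ∃ V : κ → Set ℕ, (∀ β, V β ∈ p) ∧ LinkedRefines V U) :
    IsWeakPPoint.{u} p := by
  classical
  refine ⟨hfree, fun {ι} _ q hq hqf => ?_⟩
  by_cases hι : Nonempty ι
  swap
  · exact ⟨Set.univ, Filter.univ_mem, fun j => absurd ⟨j⟩ hι⟩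
  obtain ⟨g, hg⟩ := exists_surjective_nat ι
  have hex : ∀ n, ∃ U ∈ p, U ∉ q (g n) := by
    intro n
    by_contra! hc
    exact hq (g n) (Ultrafilter.coe_le_coe.1 fun U hU => hc U hU)
  choose U hUp hUq using hex
  obtain ⟨V, hV, hlink⟩ := h U hUp
  by_contra! hc
  have hc' : ∀ β, ∃ n, V β ∈ q (g n) := fun β => by
    obtain ⟨j, hj⟩ := hc (V β) (hV β)
    obtain ⟨n, rfl⟩ := hg j
    exact ⟨n, hj⟩
  choose N hN using hc'
  obtain ⟨n, hn⟩ : ∃ n, (N ⁻¹' {n}).Infinite := by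
    by_contra! hfin
    have : (Set.univ : Set κ).Countable := by
      have h1 : (Set.univ : Set κ) = ⋃ n, N ⁻¹' {n} := by
        ext β
        simp
      rw [h1]
      exact Set.countable_iUnion fun n => (hfin n).countable
    exact Set.not_countable_univ this
  obtain ⟨T, hT, hTc⟩ := hn.exists_subset_card_eq (n + 1)
  have h1 : ∀ᶠ i in (q (g n) : Filter ℕ), ∀ β ∈ T, i ∈ V β := by
    rw [eventually_all_finset]
    intro β hβ
    have : N β = n := hT hβ
    have h2 := hN β
    rw [this] at h2
    exact h2
  have h2 := hqf (g n) (hlink n T (by omega))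
  refine hUq n ?_
  filter_upwards [h1, h2] with i hi1 hi2
  exact hi2 hi1

open IndependentLinkedFamily in
/-- There are `2 ^ 𝔠` weak P-points. -/
theorem exists_injective_isWeakPPoint :
    ∃ p : Set (Set ℕ) → Ultrafilter ℕ, Function.Injective p ∧ ∀ x, IsWeakPPoint.{u} (p x) := by
  classical
  obtain ⟨e⟩ : Nonempty ((Set ℕ ⊕ Set ℕ) ↪ Set ℕ) := by
    rw [← Cardinal.le_def]
    simp
  obtain ⟨M⟩ := exists_independentLinkedFamily e
  -- Left rows code `x` by the choice between two columns, whose level `1` sets are almost disjoint;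
  -- right rows are kept for the recursion.
  let col : Set (Set ℕ) → Set ℕ ⊕ Set ℕ → Finset (Set ℕ) := fun x α =>
    Sum.elim (fun α => if α ∈ x then {∅} else {Set.univ}) (fun _ => ∅) α
  let base : Set (Set ℕ) → Filter ℕ := fun x =>
    ⨅ t : Finset (Set ℕ), cofinite ⊓ 𝓟 (M.block (t.map Function.Embedding.inl) (col x))
  have hbase : ∀ x, M.IndepMod (base x) (Set.range Sum.inr) := by
    intro x s c hs
    rw [iInf_inf]
    have hdir : Directed (· ≥ ·) fun t : Finset (Set ℕ) =>
        cofinite ⊓ 𝓟 (M.block (t.map Function.Embedding.inl) (col x)) ⊓ 𝓟 (M.block s c) := by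
      refine directed_of_isDirected_le fun t t' h => ?_
      refine inf_le_inf_right _ (inf_le_inf_left _ (principal_mono.2 ?_))
      exact fun i hi α hα => hi α (Finset.map_subset_map.2 h hα)
    rw [iInf_neBot_iff_of_directed hdir]
    intro t
    have hd : Disjoint (t.map Function.Embedding.inl) s := by
      rw [Finset.disjoint_left]
      intro a ha has
      obtain ⟨b, _, rfl⟩ := Finset.mem_map.1 ha
      obtain ⟨b', hb'⟩ := hs has
      simp at hb'
    rw [inf_assoc, inf_principal, ← M.block_union hd, cofinite_inf_principal_neBot_iff]
    exact M.independent _ _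
  have hex : ∀ x, ∃ p : Ultrafilter ℕ, (p : Filter ℕ) ≤ base x ∧ IsWeakPPoint.{u} p := by
    intro x
    have hcof : base x ≤ cofinite := (iInf_le _ ∅).trans inf_le_left
    obtain ⟨F, hF, hne, hset⟩ := M.exists_forall_settles hcof (hbase x) (by
      rw [mk_range_eq _ Sum.inr_injective]
      simp)
    refine ⟨Ultrafilter.of F, (Ultrafilter.of_le F).trans hF, ?_⟩
    have : Uncountable (Set ℕ) := by
      rw [← Cardinal.aleph0_lt_mk_iff]
      simpa using aleph0_lt_continuum
    exact isWeakPPoint_of_linkedRefines ((Ultrafilter.of_le F).trans (hF.trans hcof))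
      fun U hU => hset U _ (Ultrafilter.of_le F) hU
  choose p hp hw using hex
  refine ⟨p, ?_, hw⟩
  have haux : ∀ x y, p x = p y → x ⊆ y := by
    intro x y hxy α hα
    by_contra hy
    have h1 : M.block (({α} : Finset (Set ℕ)).map Function.Embedding.inl) (col x) ∈ p x :=
      hp x (mem_iInf_of_mem {α} (mem_inf_of_right (mem_principal_self _)))
    have h2 : M.block (({α} : Finset (Set ℕ)).map Function.Embedding.inl) (col y) ∈ p y :=
      hp y (mem_iInf_of_mem {α} (mem_inf_of_right (mem_principal_self _)))
    rw [← hxy] at h2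
    have hfin := M.linked (Sum.inl α) {∅, Set.univ} 1 (by
      rw [Finset.card_pair Set.empty_ne_univ]
      norm_num)
    have h3 := (hw x).free hfin.compl_mem_cofinite
    obtain ⟨i, ⟨hi1, hi2⟩, hi3⟩ := (p x).nonempty_of_mem
      (Filter.inter_mem (Filter.inter_mem h1 h2) h3)
    refine hi3 fun β hβ => ?_
    have e1 := hi1 (Sum.inl α) (by simp)
    have e2 := hi2 (Sum.inl α) (by simp)
    simp only [col, Sum.elim_inl, if_pos hα, if_neg hy, Finset.mem_singleton, forall_eq,
      Finset.card_singleton] at e1 e2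
    rcases Finset.mem_insert.1 hβ with rfl | hβ
    · exact e1
    · rw [Finset.mem_singleton.1 hβ]
      exact e2
  intro x y hxy
  exact Set.Subset.antisymm (haux x y hxy) (haux y x hxy.symm)

/-- There are `2 ^ 𝔠` weak P-points which are pairwise not isomorphic. -/
theorem exists_isWeakPPoint_pairwise_not_isomorphic :
    ∃ p : Set (Set ℕ) → Ultrafilter ℕ, (∀ x, IsWeakPPoint.{u} (p x)) ∧
      ∀ x y, ∀ f g : ℕ → ℕ, (p x).map f = p y → (p y).map g = p x → x = y := by
  obtain ⟨p, hinj, hp⟩ := exists_injective_isWeakPPoint.{u}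
  let S : Setoid (Set (Set ℕ)) :=
    { r := fun x y => ∃ f g : ℕ → ℕ, (p x).map f = p y ∧ (p y).map g = p x
      iseqv :=
        { refl := fun x => ⟨id, id, Ultrafilter.map_id _, Ultrafilter.map_id _⟩
          symm := fun ⟨f, g, h1, h2⟩ => ⟨g, f, h2, h1⟩
          trans := fun ⟨f, g, h1, h2⟩ ⟨f', g', h3, h4⟩ =>
            ⟨f' ∘ f, g ∘ g', by rw [← Ultrafilter.map_map, h1, h3],
              by rw [← Ultrafilter.map_map, h4, h2]⟩ } }
  have hcard : #(Set (Set ℕ)) = 2 ^ 𝔠 := by simp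
  have hle : #(Set (Set ℕ)) ≤ #(Quotient S) := by
    by_contra! hlt
    have h1 : #(Set (Set ℕ)) ≤ #(Quotient S) * 𝔠 := by
      have h2 : #(Set (Set ℕ)) ≤ #(Quotient S × (ℕ → ℕ)) := by
        have hex : ∀ x : Set (Set ℕ), ∃ f : ℕ → ℕ,
            (p (Quotient.out (Quotient.mk S x))).map f = p x := fun x => by
          obtain ⟨f, g, h, _⟩ := Quotient.mk_out (s := S) x
          exact ⟨f, h⟩
        choose f hf using hex
        refine mk_le_of_injective (f := fun x => (Quotient.mk S x, f x)) fun x y hxy => ?_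
        simp only [Prod.mk.injEq] at hxy
        refine hinj ?_
        rw [← hf x, ← hf y, hxy.1, hxy.2]
      simpa using h2
    have h3 : #(Quotient S) * 𝔠 < #(Set (Set ℕ)) := by
      refine mul_lt_of_lt (aleph0_le_mk _) hlt ?_
      rw [hcard]
      exact cantor 𝔠
    exact absurd h1 h3.not_ge
  obtain ⟨j⟩ := Cardinal.le_def _ _ |>.1 hle
  refine ⟨fun x => p (Quotient.out (j x)), fun x => hp _, fun x y f g h1 h2 => ?_⟩
  refine j.injective ?_
  rw [← Quotient.out_equiv_out]
  exact ⟨f, g, h1, h2⟩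

/-- Where `s τ` runs inside the range of `s σ` almost everywhere, `p τ` is transported to an
ultrafilter on the indices of `s σ`. It is free by injectivity and differs from `p σ` by
non-isomorphism, so the weak P-point property excludes all of these at once. -/
theorem IsWeakPPoint.exists_mem_forall_preimage_notMem {X S : Type u} [Countable S]
    {p : S → Ultrafilter ℕ} (hp : ∀ σ, IsWeakPPoint.{u} (p σ))
    (hiso : ∀ σ τ, ∀ f g : ℕ → ℕ, (p σ).map f = p τ → (p τ).map g = p σ → σ = τ)
    {s : S → ℕ → X} (hs : ∀ σ, Function.Injective (s σ)) (σ : S) :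
    ∃ I ∈ p σ, ∀ τ, τ ≠ σ → s τ ⁻¹' (s σ '' I) ∉ p τ := by
  let J := {τ : S // τ ≠ σ ∧ s τ ⁻¹' (Set.range (s σ)) ∈ p τ}
  let f : J → ℕ → ℕ := fun τ n => Function.invFun (s σ) (s τ n)
  have hf : ∀ (τ : J) n, s τ n ∈ Set.range (s σ) → s σ (f τ n) = s τ n := fun τ n h =>
    Function.invFun_eq h
  obtain ⟨I, hI, hIq⟩ := (hp σ).exists_notMem (fun τ : J => (p τ).map (f τ)) (by
    intro τ h
    refine τ.2.1 (hiso _ _ (f τ) (fun n => Function.invFun (s τ) (s σ n)) h ?_)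
    refine Ultrafilter.coe_le_coe.1 ?_
    rw [← h]
    intro A hA
    change {n | Function.invFun (s τ) (s σ (f τ n)) ∈ A} ∈ p τ
    filter_upwards [hA, τ.2.2] with n hn hn'
    rw [hf τ n hn', Function.leftInverse_invFun (hs τ)]
    exact hn) (by
    intro τ A hA
    change f τ ⁻¹' A ∈ p τ
    have hfin : {n | s τ n ∈ Set.range (s σ) ∧ f τ n ∉ A}.Finite := by
      refine Set.Finite.of_finite_image (f := f τ) (Set.Finite.subset (mem_cofinite.1 hA) ?_) ?_
      · rintro _ ⟨n, hn, rfl⟩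
        exact hn.2
      · intro n hn m hm hnm
        refine hs τ ?_
        rw [← hf τ n hn.1, hnm, hf τ m hm.1]
    filter_upwards [(hp τ).free hfin.compl_mem_cofinite, τ.2.2] with n hn hn'
    by_contra hc
    exact hn ⟨hn', hc⟩)
  refine ⟨I, hI, fun τ hτ hmem => ?_⟩
  have hτJ : s τ ⁻¹' (Set.range (s σ)) ∈ p τ :=
    mem_of_superset hmem (Set.preimage_mono (Set.image_subset_range _ _))
  refine hIq ⟨τ, hτ, hτJ⟩ ?_
  change f ⟨τ, hτ, hτJ⟩ ⁻¹' I ∈ p τ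
  filter_upwards [hmem] with n hn
  obtain ⟨m, hm, hmn⟩ := hn
  change Function.invFun (s σ) (s τ n) ∈ I
  rw [← hmn, Function.leftInverse_invFun (hs σ)]
  exact hm

/-- Countably many injective sequences, which converge along pairwise non-isomorphic weak
P-points, have pairwise disjoint subsequences avoiding a given finite set. -/
theorem IsWeakPPoint.exists_pairwise_disjoint {X S : Type u} [Countable S]
    {p : S → Ultrafilter ℕ} (hp : ∀ σ, IsWeakPPoint.{u} (p σ))
    (hiso : ∀ σ τ, ∀ f g : ℕ → ℕ, (p σ).map f = p τ → (p τ).map g = p σ → σ = τ)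
    {s : S → ℕ → X} (hs : ∀ σ, Function.Injective (s σ)) {E : Set X} (hE : E.Finite) :
    ∃ J : S → Set ℕ, (∀ σ, J σ ∈ p σ) ∧ (∀ σ, ∀ n ∈ J σ, s σ n ∉ E) ∧
      ∀ σ τ, ∀ m ∈ J σ, ∀ n ∈ J τ, s σ m = s τ n → σ = τ := by
  choose I hI hIn using exists_mem_forall_preimage_notMem hp hiso hs
  obtain ⟨g, hg⟩ := exists_injective_nat S
  -- Along an enumeration of `S`, only the finitely many earlier sequences have to be avoided.
  refine ⟨fun σ => {n | n ∈ I σ ∧ s σ n ∉ E ∧ ∀ τ, g τ < g σ → s σ n ∉ s τ '' I τ},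
    fun σ => ?_, fun σ n hn => hn.2.1, ?_⟩
  · have h1 : ∀ᶠ n in (p σ : Filter ℕ), s σ n ∉ E :=
      (hp σ).free (hE.preimage (hs σ).injOn).compl_mem_cofinite
    have h2 : ∀ᶠ n in (p σ : Filter ℕ), ∀ τ ∈ g ⁻¹' Set.Iio (g σ), s σ n ∉ s τ '' I τ := by
      rw [eventually_all_finite ((Set.finite_Iio _).preimage hg.injOn)]
      intro τ hτ
      refine Ultrafilter.compl_mem_iff_notMem.2 (hIn τ σ ?_)
      rintro rfl
      exact lt_irrefl (g σ) hτ
    filter_upwards [hI σ, h1, h2] with n hn1 hn2 hn3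
    exact ⟨hn1, hn2, hn3⟩
  · intro σ τ m hm n hn h
    rcases lt_trichotomy (g σ) (g τ) with hlt | heq | hlt
    · exact absurd ⟨m, hm.1, h⟩ (hn.2.2 σ hlt)
    · exact hg heq
    · exact absurd ⟨n, hn.1, h.symm⟩ (hm.2.2 τ hlt)

/-! ### The space of trees -/

/-- Trees with countably many kinds of leaves whose nodes carry a label in `L` and two sequences
of subtrees. -/
inductive SeqTree (L : Type u) : Type u
  | leaf : ℕ → SeqTree L
  | node : L → (Bool → ℕ → SeqTree L) → SeqTree L

namespace SeqTree

variable {L : Type u}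

theorem leaf_injective : Function.Injective (leaf : ℕ → SeqTree L) :=
  fun _ _ h => by injection h

open Classical in
/-- An injective sequence of subtrees: the prescribed one if it is injective, and the sequence of
leaves otherwise. -/
noncomputable def strand : SeqTree L → Bool → ℕ → SeqTree L
  | leaf _, _ => leaf
  | node _ c, i => if Function.Injective (c i) then c i else leaf

theorem strand_node_of_injective (l : L) {c : Bool → ℕ → SeqTree L} {i : Bool}
    (h : Function.Injective (c i)) : (node l c).strand i = c i := by
  rw [strand, if_pos h]

theorem strand_injective (z : SeqTree L) (i : Bool) : Function.Injective (z.strand i) := by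
  cases z with
  | leaf => exact leaf_injective
  | node l c =>
    rw [strand]
    split_ifs with h
    · exact h
    · exact leaf_injective

/-- The trees reachable from a given one. -/
def reach : SeqTree L → Set (SeqTree L)
  | leaf n => {leaf n}
  | node l c => insert (node l c) (Set.range leaf ∪ ⋃ (i : Bool) (n : ℕ), reach (c i n))

theorem self_mem_reach (z : SeqTree L) : z ∈ reach z := by
  cases z with
  | leaf => exact rfl
  | node => exact Set.mem_insert _ _

theorem countable_reach (z : SeqTree L) : (reach z).Countable := by
  induction z with
  | leaf n => exact Set.countable_singleton _
  | node l c ih =>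
    exact ((Set.countable_range _).union
      (Set.countable_iUnion fun i => Set.countable_iUnion fun n => ih i n)).insert _

/-- A tree which is not a leaf. -/
def IsNode : SeqTree L → Prop
  | leaf _ => False
  | node _ _ => True

theorem strand_mem_reach {z w : SeqTree L} (hw : w ∈ reach z) (hn : w.IsNode) (i : Bool) (n : ℕ) :
    w.strand i n ∈ reach z := by
  induction z with
  | leaf m =>
    rw [reach, Set.mem_singleton_iff] at hw
    subst hw
    exact hn.elim
  | node l c ih =>
    rw [reach] at hw ⊢
    rcases hw with rfl | ⟨m, rfl⟩ | hw
    · rw [strand]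
      split_ifs
      · exact Or.inr (Or.inr (Set.mem_iUnion₂.2 ⟨i, n, self_mem_reach _⟩))
      · exact Or.inr (Or.inl ⟨n, rfl⟩)
    · exact hn.elim
    · obtain ⟨j, m, hw⟩ := Set.mem_iUnion₂.1 hw
      exact Or.inr (Or.inr (Set.mem_iUnion₂.2 ⟨j, m, ih j m hw⟩))

/-- The topology in which a node is the limit of each of its two sequences along prescribed
ultrafilters, and leaves are isolated. -/
abbrev topology (p : SeqTree L × Bool → Ultrafilter ℕ) : TopologicalSpace (SeqTree L) where
  IsOpen U := ∀ z ∈ U, z.IsNode → ∀ i, z.strand i ⁻¹' U ∈ p (z, i)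
  isOpen_univ _ _ _ _ := Filter.univ_mem
  isOpen_inter U V hU hV z hz hn i :=
    Filter.inter_mem (hU z hz.1 hn i) (hV z hz.2 hn i)
  isOpen_sUnion S hS z hz hn i := by
    obtain ⟨U, hU, hzU⟩ := hz
    exact mem_of_superset (hS U hU z hzU hn i) (Set.preimage_mono (Set.subset_sUnion_of_mem hU))

section

variable (p : SeqTree L × Bool → Ultrafilter ℕ)

theorem isOpen_iff {U : Set (SeqTree L)} : IsOpen[topology p] U ↔
    ∀ z ∈ U, z.IsNode → ∀ i, z.strand i ⁻¹' U ∈ p (z, i) := Iff.rfl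

theorem isOpen_reach (z : SeqTree L) : IsOpen[topology p] (reach z) := by
  rw [isOpen_iff]
  intro w hw hn i
  exact mem_of_superset Filter.univ_mem fun n _ => strand_mem_reach hw hn i n

theorem node_mem_of_isClosed {F : Set (SeqTree L)} (hF : IsClosed[topology p] F) {z : SeqTree L}
    (hz : z.IsNode) (i : Bool) (h : ∀ n, z.strand i n ∈ F) : z ∈ F := by
  by_contra hc
  have h1 := (isOpen_iff p).1 hF.isOpen_compl z hc hz i
  obtain ⟨n, hn⟩ := (p (z, i)).nonempty_of_mem h1
  exact hn (h n)

/-- The open sets `reach z` shrink on passing to subtrees, so well-foundedness yields one that meets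
`A` in a single point. -/
theorem isScatteredSpace : @IsScatteredSpace (SeqTree L) (topology p) := by
  intro A hA
  have hex : ∀ z, (reach z ∩ A).Nonempty → ∃ x ∈ A, reach x ∩ A = {x} := by
    have hleaf : ∀ n, (leaf n : SeqTree L) ∈ A → ∃ x ∈ A, reach x ∩ A = {x} := fun n hn => by
      refine ⟨_, hn, ?_⟩
      rw [reach]
      exact Set.inter_eq_left.2 (Set.singleton_subset_iff.2 hn)
    intro z
    induction z with
    | leaf n =>
      rintro ⟨_, rfl, hz⟩
      exact hleaf n hz
    | node l c ih =>
      rintro ⟨v, hv, hvA⟩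
      by_cases h1 : ∃ n, (leaf n : SeqTree L) ∈ A
      · obtain ⟨n, hn⟩ := h1
        exact hleaf n hn
      by_cases h2 : ∃ i n, (reach (c i n) ∩ A).Nonempty
      · obtain ⟨i, n, h⟩ := h2
        exact ih i n h
      · have hsub : ∀ w ∈ reach (node l c) ∩ A, w = node l c := by
          rintro w ⟨hw, hwA⟩
          rcases hw with rfl | ⟨m, rfl⟩ | hw
          · rfl
          · exact absurd ⟨m, hwA⟩ h1
          · obtain ⟨j, m, hw⟩ := Set.mem_iUnion₂.1 hw
            exact absurd ⟨j, m, w, hw, hwA⟩ h2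
        obtain rfl := hsub v ⟨hv, hvA⟩
        exact ⟨_, hvA, Set.Subset.antisymm hsub (Set.singleton_subset_iff.2 ⟨hv, hvA⟩)⟩
  obtain ⟨z, hz⟩ := hA
  obtain ⟨x, hx, hxA⟩ := hex z ⟨z, self_mem_reach z, hz⟩
  exact ⟨x, hx, reach x, isOpen_reach p x, hxA⟩

theorem separableSpace : @TopologicalSpace.SeparableSpace (SeqTree L) (topology p) := by
  let _ := topology p
  refine ⟨⟨Set.range leaf, Set.countable_range _, fun z => ?_⟩⟩
  induction z with
  | leaf n => exact subset_closure ⟨n, rfl⟩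
  | node l c ih =>
    refine node_mem_of_isClosed p isClosed_closure (z := node l c) trivial true fun n => ?_
    rw [strand]
    split_ifs
    · exact ih true n
    · exact subset_closure ⟨n, rfl⟩

theorem not_isOpen_singleton {z : SeqTree L} (hz : z.IsNode) (hp : ∀ σ, IsWeakPPoint.{u} (p σ)) :
    ¬ IsOpen[topology p] {z} := by
  intro h
  have h1 := (isOpen_iff p).1 h z rfl hz true
  have h2 : (z.strand true ⁻¹' {z}).Finite :=
    (Set.finite_singleton z).preimage (strand_injective z true).injOn
  obtain ⟨n, hn, hn'⟩ := (p (z, true)).nonempty_of_mem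
    (Filter.inter_mem h1 ((hp (z, true)).free h2.compl_mem_cofinite))
  exact hn' hn

/-- Thinned strands are disjoint, so each point has at most one parent and the descendants of a
point form an open set. Neither `x` nor `y` has a parent, so their descendants are disjoint. -/
theorem t2Space (hp : ∀ σ, IsWeakPPoint.{u} (p σ))
    (hiso : ∀ σ τ, ∀ f g : ℕ → ℕ, (p σ).map f = p τ → (p τ).map g = p σ → σ = τ) :
    @T2Space (SeqTree L) (topology p) := by
  let _ := topology p
  refine ⟨fun x y hxy => ?_⟩
  let C : Set (SeqTree L) := reach x ∪ reach y
  have hC : C.Countable := (countable_reach x).union (countable_reach y)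
  have hCs : ∀ z ∈ C, z.IsNode → ∀ i n, z.strand i n ∈ C := by
    rintro z (hz | hz) hn i n
    · exact Or.inl (strand_mem_reach hz hn i n)
    · exact Or.inr (strand_mem_reach hz hn i n)
  have := hC.to_subtype
  obtain ⟨J, hJ, hJE, hJd⟩ := IsWeakPPoint.exists_pairwise_disjoint
    (p := fun σ : C × Bool => p (σ.1, σ.2)) (s := fun σ : C × Bool => strand σ.1.1 σ.2)
    (fun σ => hp _) (fun σ τ f g h1 h2 => by
      have := hiso _ _ f g h1 h2
      simp only [Prod.mk.injEq] at this
      exact Prod.ext (Subtype.ext this.1) this.2)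
    (fun σ => strand_injective _ _) (E := {x, y}) (by simp)
  let r : SeqTree L → SeqTree L → Prop := fun b a =>
    ∃ (h : a ∈ C) (i : Bool), a.IsNode ∧ ∃ n ∈ J (⟨a, h⟩, i), a.strand i n = b
  have hr : Relator.RightUnique r := by
    rintro b a a' ⟨h, i, _, n, hn, hb⟩ ⟨h', i', _, n', hn', hb'⟩
    have := hJd _ _ n hn n' hn' (hb.trans hb'.symm)
    simp only [Prod.mk.injEq, Subtype.mk.injEq] at this
    exact this.1
  have hrE : ∀ b ∈ ({x, y} : Set (SeqTree L)), ∀ a, ¬ r b a := by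
    rintro b hb a ⟨h, i, _, n, hn, rfl⟩
    exact hJE _ n hn hb
  have hxy' : ∀ b ∈ ({x, y} : Set (SeqTree L)), ∀ a, Relation.ReflTransGen r b a → b = a := by
    intro b hb a h
    rcases Relation.ReflTransGen.cases_head h with h | ⟨c, h, _⟩
    · exact h
    · exact absurd h (hrE b hb c)
  have hopen : ∀ a ∈ C, IsOpen {w | w ∈ C ∧ Relation.ReflTransGen r w a} := by
    intro a _
    refine (isOpen_iff p).2 fun z hz hn i => ?_
    refine mem_of_superset (hJ (⟨z, hz.1⟩, i)) fun n hn' => ⟨hCs z hz.1 hn i n, ?_⟩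
    exact Relation.ReflTransGen.head ⟨hz.1, i, hn, n, hn', rfl⟩ hz.2
  refine ⟨_, _, hopen x (Or.inl (self_mem_reach x)), hopen y (Or.inr (self_mem_reach y)),
    ⟨Or.inl (self_mem_reach x), .refl⟩, ⟨Or.inr (self_mem_reach y), .refl⟩, ?_⟩
  rw [Set.disjoint_left]
  rintro w ⟨_, hwx⟩ ⟨_, hwy⟩
  -- The ancestors of `w` form a chain, so one of `x`, `y` would descend from the other.
  rcases Relation.ReflTransGen.total_of_right_unique hr hwx hwy with h | h
  · exact hxy (hxy' x (by simp) y h)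
  · exact hxy (hxy' y (by simp) x h).symm

theorem isSAU [Nontrivial L] (hp : ∀ σ, IsWeakPPoint.{u} (p σ))
    (hiso : ∀ σ τ, ∀ f g : ℕ → ℕ, (p σ).map f = p τ → (p τ).map g = p σ → σ = τ) :
    @IsSAU (SeqTree L) (topology p) := by
  let _ := topology p
  refine ⟨t2Space p hp hiso, ?_, ?_⟩
  · obtain ⟨l, l', h⟩ := exists_pair_ne L
    refine ⟨node l fun _ => leaf, node l' fun _ => leaf, fun he => ?_,
      not_isOpen_singleton p trivial hp, not_isOpen_singleton p trivial hp⟩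
    injection he with he
    exact h he
  · intro F G hF hG hFi hGi
    let a := hFi.natEmbedding
    let b := hGi.natEmbedding
    obtain ⟨l⟩ : Nonempty L := inferInstance
    let z : SeqTree L := node l fun i n => if i then (a n : SeqTree L) else b n
    have ha : ∀ n, z.strand true n = a n := by
      intro n
      rw [strand_node_of_injective]
      · simp
      · intro m m' h
        exact a.injective (Subtype.ext (by simpa using h))
    have hb : ∀ n, z.strand false n = b n := by
      intro n
      rw [strand_node_of_injective]
      · simp
      · intro m m' h
        exact b.injective (Subtype.ext (by simpa using h))
    refine ⟨z, node_mem_of_isClosed p hF (z := z) trivial true fun n => ?_,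
      node_mem_of_isClosed p hG (z := z) trivial false fun n => ?_⟩
    · rw [ha]
      exact (a n).2
    · rw [hb]
      exact (b n).2

end

/-- The trees embed in a W-type with at most `κ` constructors of countable arity, and the labels
give the lower bound. -/
theorem mk_eq {κ : Cardinal.{u}} (hL : #L = κ) (hκ : κ ^ ℵ₀ = κ) (h2 : ℵ₀ ≤ κ) :
    #(SeqTree L) = κ := by
  refine le_antisymm ?_ ?_
  · let B : ULift.{u} ℕ ⊕ L → Type u :=
      Sum.elim (fun _ => ULift.{u} Empty) (fun _ => ULift.{u} (Bool × ℕ))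
    let enc : SeqTree L → WType B := fun z => SeqTree.rec
      (fun n => WType.mk (Sum.inl ⟨n⟩) (fun e => e.down.elim))
      (fun l _ ih => WType.mk (Sum.inr l) (fun b => ih b.down.1 b.down.2)) z
    have henc : Function.Injective enc := by
      intro z
      induction z with
      | leaf n =>
        intro w h
        cases w with
        | leaf m =>
          simp only [enc, WType.mk.injEq, Sum.inl.injEq, ULift.up.injEq] at h
          rw [h.1]
        | node l c => simp [enc] at h
      | node l c ih =>
        intro w h
        cases w with
        | leaf m => simp [enc] at h
        | node l' c' =>
          simp only [enc, WType.mk.injEq, Sum.inr.injEq] at h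
          obtain ⟨rfl, h⟩ := h
          congr 1
          funext i n
          exact ih i n (congrFun (eq_of_heq h) ⟨(i, n)⟩)
    refine (mk_le_of_injective henc).trans (WType.cardinalMk_le_of_le ?_)
    refine (sum_le_sum _ (fun _ => κ) fun a => ?_).trans ?_
    · rcases a with a | a
      · simpa [B] using (one_le_aleph0.trans h2)
      · simp [B, hκ]
    · rw [sum_const', mk_sum, hL]
      simp only [mk_uLift, mk_nat, lift_aleph0, lift_id]
      rw [add_eq_right h2 h2, mul_eq_self h2]
  · rw [← hL]
    refine mk_le_of_injective (f := fun l : L => node l fun _ => leaf) fun l l' h => ?_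
    injection h

end SeqTree

theorem exists_separable_scattered_isSAU :
    ∃ (X : Type u) (_ : TopologicalSpace X),
      IsSAU X ∧ TopologicalSpace.SeparableSpace X ∧ IsScatteredSpace X ∧
        #X = (2 : Cardinal.{u}) ^ Cardinal.continuum.{u} := by
  let L : Type u := ULift.{u} (Set (Set ℕ))
  have hL : #L = 2 ^ 𝔠 := by simp [L]
  have hinf : ℵ₀ ≤ (2 : Cardinal.{u}) ^ 𝔠 := aleph0_le_continuum.trans (cantor 𝔠).le
  have hX : #(SeqTree L) = 2 ^ 𝔠 := SeqTree.mk_eq hL (by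
    rw [← power_mul, continuum_mul_aleph0]) hinf
  obtain ⟨q, hq, hiso⟩ := exists_isWeakPPoint_pairwise_not_isomorphic.{u}
  obtain ⟨e⟩ : Nonempty ((SeqTree L × Bool) ↪ L) := by
    rw [← Cardinal.le_def, mk_prod, hX, hL]
    simp only [lift_uzero, mk_bool, lift_ofNat]
    exact (mul_eq_left hinf (by exact (natCast_lt_aleph0 (n := 2)).le.trans hinf) two_ne_zero).le
  let p : SeqTree L × Bool → Ultrafilter ℕ := fun σ => q (e σ).down
  have : Nontrivial L := inferInstance
  refine ⟨SeqTree L, SeqTree.topology p, SeqTree.isSAU p (fun σ => hq _) ?_,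
    SeqTree.separableSpace p, SeqTree.isScatteredSpace p, hX⟩
  intro σ τ f g h1 h2
  exact e.injective (ULift.down_injective (hiso _ _ f g h1 h2))

/-! ### The coarsening `X_r` and its full points -/

section RegularOpen

variable {X : Type u} [TopologicalSpace X]

theorem IsRegularOpenSet.isOpen {U : Set X} (h : IsRegularOpenSet U) : IsOpen U := by
  rw [← h]
  exact isOpen_interior

theorem isRegularOpenSet_interior_closure (U : Set X) : IsRegularOpenSet (interior (closure U)) :=
  interior_closure_idem

theorem IsRegularOpenSet.inter {U V : Set X} (hU : IsRegularOpenSet U) (hV : IsRegularOpenSet V) :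
    IsRegularOpenSet (U ∩ V) := by
  refine Set.Subset.antisymm (Set.subset_inter ?_ ?_)
    (interior_maximal subset_closure (hU.isOpen.inter hV.isOpen))
  · exact (interior_mono (closure_mono Set.inter_subset_left)).trans hU.subset
  · exact (interior_mono (closure_mono Set.inter_subset_right)).trans hV.subset

theorem exists_isRegularOpenSet_separation [T2Space X] {x y : X} (hxy : x ≠ y) :
    ∃ U V : Set X, IsRegularOpenSet U ∧ IsRegularOpenSet V ∧ x ∈ U ∧ y ∈ V ∧ Disjoint U V := by
  obtain ⟨U, V, hU, hV, hx, hy, hd⟩ := t2_separation hxy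
  exact ⟨interior (closure U), interior (closure V), isRegularOpenSet_interior_closure U,
    isRegularOpenSet_interior_closure V, interior_maximal subset_closure hU hx,
    interior_maximal subset_closure hV hy,
    (((hd.closure_left hV).mono_left interior_subset).closure_right isOpen_interior).mono_right
      interior_subset⟩

/-- A regular open set is determined by its trace on a countable dense set. -/
theorem mk_isRegularOpenSet_le [TopologicalSpace.SeparableSpace X] [Nonempty X] :
    #{U : Set X | IsRegularOpenSet U} ≤ 𝔠 := by
  let d := TopologicalSpace.denseSeq X
  have hd : Dense (Set.range d) := TopologicalSpace.denseRange_denseSeq X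
  have hcl : ∀ U : Set X, IsOpen U → closure U = closure (U ∩ Set.range d) := fun U hU =>
    Set.Subset.antisymm (closure_minimal (hd.open_subset_closure_inter hU) isClosed_closure)
      (closure_mono Set.inter_subset_left)
  have hinj : Function.Injective
      fun U : {U : Set X | IsRegularOpenSet U} => (ULift.up.{u} (d ⁻¹' U.1)) := by
    intro U V h
    have h1 : d ⁻¹' U.1 = d ⁻¹' V.1 := ULift.up_injective h
    refine Subtype.ext ?_
    have hU : interior (closure U.1) = U.1 := U.2
    have hV : interior (closure V.1) = V.1 := V.2
    rw [← hU, ← hV, hcl U.1 (IsRegularOpenSet.isOpen U.2), hcl V.1 (IsRegularOpenSet.isOpen V.2),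
      ← Set.image_preimage_eq_inter_range, ← Set.image_preimage_eq_inter_range, h1]
  refine (mk_le_of_injective hinj).trans ?_
  simp

namespace RegularOpenCoarsening

theorem isTopologicalBasis :
    TopologicalSpace.IsTopologicalBasis (α := RegularOpenCoarsening X)
      {U : Set X | IsRegularOpenSet U} :=
  TopologicalSpace.isTopologicalBasis_of_subbasis_of_finiteInter rfl
    { univ_mem := by
        change interior (closure (Set.univ : Set X)) = Set.univ
        simp
      inter_mem := fun _ hU _ hV => IsRegularOpenSet.inter hU hV }

theorem isOpen_of_isOpen {U : Set X} (hU : IsOpen (X := RegularOpenCoarsening X) U) :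
    IsOpen U := by
  have h : instTopologicalSpaceRegularOpenCoarsening X ≥ (inferInstance : TopologicalSpace X) :=
    le_generateFrom fun U hU => IsRegularOpenSet.isOpen hU
  exact h U hU

instance [T2Space X] : T2Space (RegularOpenCoarsening X) := by
  refine ⟨fun x y hxy => ?_⟩
  obtain ⟨U, V, hU, hV, hx, hy, hd⟩ := exists_isRegularOpenSet_separation (X := X) hxy
  exact ⟨U, V, isTopologicalBasis.isOpen hU, isTopologicalBasis.isOpen hV, hx, hy, hd⟩

/-- The points all of whose neighbourhoods have size `κ`. -/
def fullPoints (X : Type u) [TopologicalSpace X] (κ : Cardinal.{u}) :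
    Set (RegularOpenCoarsening X) :=
  (⋃₀ {U : Set X | IsRegularOpenSet U ∧ #U < κ})ᶜ

theorem isClosed_fullPoints (κ : Cardinal.{u}) : IsClosed (fullPoints X κ) := by
  refine IsOpen.isClosed_compl (isOpen_sUnion fun U hU => ?_)
  exact isTopologicalBasis.isOpen hU.1

/-- At most `𝔠` small sets are united; by König's theorem their sizes are bounded below `2 ^ 𝔠`. -/
theorem mk_compl_fullPoints_lt [TopologicalSpace.SeparableSpace X] [Nonempty X] :
    #((fullPoints X (2 ^ 𝔠))ᶜ : Set (RegularOpenCoarsening X)) < 2 ^ 𝔠 := by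
  let S : Set (Set X) := {U : Set X | IsRegularOpenSet U ∧ #U < 2 ^ 𝔠}
  have h1 : #S ≤ 𝔠 := (mk_le_mk_of_subset fun U hU => hU.1).trans mk_isRegularOpenSet_le
  have hcof : 𝔠 < ((2 : Cardinal.{u}) ^ 𝔠).ord.cof :=
    lt_cof_ord_power aleph0_le_continuum one_lt_two
  have hsup : ⨆ U : S, #U.1 < 2 ^ 𝔠 := iSup_lt_of_lt_cof_ord (h1.trans_lt hcof) fun U => U.2.2
  have h2 : #(⋃₀ S : Set X) ≤ #S * ⨆ U : S, #U.1 := mk_sUnion_le S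
  have h3 : ((fullPoints X (2 ^ 𝔠))ᶜ : Set (RegularOpenCoarsening X)) = (⋃₀ S : Set X) :=
    compl_compl _
  rw [h3]
  exact h2.trans_lt (mul_lt_of_lt (aleph0_le_continuum.trans (cantor 𝔠).le)
    (h1.trans_lt (cantor 𝔠)) hsup)

/-- Were the trace small, a regular open neighbourhood inside `V` would be covered by it and the
small complement, and so would itself have been removed. -/
theorem mk_inter_fullPoints [TopologicalSpace.SeparableSpace X] (hX : #X = 2 ^ 𝔠)
    {V : Set (RegularOpenCoarsening X)} (hV : IsOpen V)
    (hne : (V ∩ fullPoints X (2 ^ 𝔠)).Nonempty) :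
    #(V ∩ fullPoints X (2 ^ 𝔠) : Set (RegularOpenCoarsening X)) = 2 ^ 𝔠 := by
  have hinf : ℵ₀ ≤ (2 : Cardinal.{u}) ^ 𝔠 := aleph0_le_continuum.trans (cantor 𝔠).le
  obtain ⟨y, hyV, hy⟩ := hne
  have : Nonempty X := ⟨y⟩
  refine le_antisymm ((mk_set_le _).trans hX.le) ?_
  by_contra! hlt
  obtain ⟨U, hU, hyU, hUV⟩ := isTopologicalBasis.exists_subset_of_mem_open hyV hV
  have h1 : #U < 2 ^ 𝔠 := by
    have hsub : U ⊆ (V ∩ fullPoints X (2 ^ 𝔠)) ∪ (fullPoints X (2 ^ 𝔠))ᶜ := fun x hx => by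
      by_cases h : x ∈ fullPoints X (2 ^ 𝔠)
      · exact Or.inl ⟨hUV hx, h⟩
      · exact Or.inr h
    exact ((mk_le_mk_of_subset hsub).trans (mk_union_le _ _)).trans_lt
      (add_lt_of_lt hinf hlt (mk_compl_fullPoints_lt (X := X)))
  exact hy ⟨U, ⟨hU, h1⟩, hyU⟩

theorem mk_isOpen_fullPoints [TopologicalSpace.SeparableSpace X] (hX : #X = 2 ^ 𝔠)
    {U : Set (fullPoints X (2 ^ 𝔠))} (hU : IsOpen U) (hne : U.Nonempty) : #U = 2 ^ 𝔠 := by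
  obtain ⟨V, hV, rfl⟩ := isOpen_induced_iff.1 hU
  rw [← mk_image_eq (s := Subtype.val ⁻¹' V) Subtype.val_injective,
    Subtype.image_preimage_coe, Set.inter_comm]
  refine mk_inter_fullPoints hX hV ?_
  obtain ⟨y, hy⟩ := hne
  exact ⟨y, hy, y.2⟩

theorem not_isOpen_singleton_fullPoints [TopologicalSpace.SeparableSpace X] (hX : #X = 2 ^ 𝔠)
    (y : fullPoints X (2 ^ 𝔠)) : ¬ IsOpen {y} := by
  intro h
  have h1 := mk_isOpen_fullPoints hX h (Set.singleton_nonempty y)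
  rw [mk_singleton] at h1
  exact (one_lt_aleph0.trans_le (aleph0_le_continuum.trans (cantor 𝔠).le)).ne h1

theorem mk_fullPoints [TopologicalSpace.SeparableSpace X] (hX : #X = 2 ^ 𝔠) :
    #(fullPoints X (2 ^ 𝔠)) = 2 ^ 𝔠 := by
  have hinf : ℵ₀ ≤ (2 : Cardinal.{u}) ^ 𝔠 := aleph0_le_continuum.trans (cantor 𝔠).le
  have : Nonempty X := by
    rw [← mk_ne_zero_iff, hX]
    exact (aleph0_pos.trans_le hinf).ne'
  refine le_antisymm ((mk_set_le _).trans hX.le) ?_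
  by_contra! hlt
  have h1 := add_lt_of_lt hinf hlt (mk_compl_fullPoints_lt (X := X))
  rw [mk_sum_compl] at h1
  exact h1.ne hX

theorem isSAU_fullPoints [TopologicalSpace.SeparableSpace X] (hX : #X = 2 ^ 𝔠) (h : IsSAU X) :
    IsSAU (fullPoints X (2 ^ 𝔠)) := by
  have := h.t2
  refine ⟨inferInstance, ?_, fun F G hF hG hFi hGi => ?_⟩
  · have : Nontrivial (fullPoints X (2 ^ 𝔠)) := by
      rw [← one_lt_iff_nontrivial, mk_fullPoints hX]
      exact one_lt_aleph0.trans_le (aleph0_le_continuum.trans (cantor 𝔠).le)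
    obtain ⟨x, y, hxy⟩ := exists_pair_ne (fullPoints X (2 ^ 𝔠))
    exact ⟨x, y, hxy, not_isOpen_singleton_fullPoints hX x, not_isOpen_singleton_fullPoints hX y⟩
  -- Coarsening only removes closed sets, so a set closed in `Y` is closed in the original topology.
  · have hcl : ∀ F : Set (fullPoints X (2 ^ 𝔠)), IsClosed F →
        IsClosed (X := X) (Subtype.val '' F) := fun F hF =>
      ⟨isOpen_of_isOpen ((isClosed_fullPoints _).isClosedEmbedding_subtypeVal.isClosedMap F hF
        |>.isOpen_compl)⟩
    obtain ⟨_, ⟨x, hx, rfl⟩, ⟨y, hy, hxy⟩⟩ := h.inter_nonempty _ _ (hcl F hF) (hcl G hG)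
      (hFi.image Subtype.val_injective.injOn) (hGi.image Subtype.val_injective.injOn)
    rw [Subtype.val_injective hxy] at hy
    exact ⟨x, hx, hy⟩

theorem perfectSpace_fullPoints [TopologicalSpace.SeparableSpace X] (hX : #X = 2 ^ 𝔠) :
    PerfectSpace (fullPoints X (2 ^ 𝔠)) := by
  rw [perfectSpace_iff_forall_not_isolated]
  intro y
  rw [neBot_iff, Ne, ← isOpen_singleton_iff_punctured_nhds]
  exact not_isOpen_singleton_fullPoints hX y

end RegularOpenCoarsening

theorem dispersionCharacter_eq {Y : Type u} [TopologicalSpace Y] [Nonempty Y] {κ : Cardinal.{u}}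
    (h : ∀ U : Set Y, IsOpen U → U.Nonempty → #U = κ) : dispersionCharacter Y = κ := by
  have : {μ : Cardinal.{u} | ∃ U : Set Y, IsOpen U ∧ U.Nonempty ∧ μ = #U} = {κ} := by
    ext μ
    constructor
    · rintro ⟨U, hU, hne, rfl⟩
      exact h U hU hne
    · rintro rfl
      exact ⟨Set.univ, isOpen_univ, Set.univ_nonempty, (h _ isOpen_univ Set.univ_nonempty).symm⟩
  rw [dispersionCharacter, this, csInf_singleton]

end RegularOpen

open RegularOpenCoarsening in
theorem theorem4p1 :
    (∃ (X : Type u) (_ : TopologicalSpace X),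
      IsSAU X ∧ TopologicalSpace.SeparableSpace X ∧ IsScatteredSpace X ∧
        #X = (2 : Cardinal.{u}) ^ Cardinal.continuum.{u}) ∧
    (∀ (X : Type u) [TopologicalSpace X],
      IsSAU X → TopologicalSpace.SeparableSpace X →
      #X = (2 : Cardinal.{u}) ^ Cardinal.continuum.{u} →
      ∃ Y : Set (RegularOpenCoarsening X),
        IsClosed Y ∧ IsSAU Y ∧
        dispersionCharacter Y = (2 : Cardinal.{u}) ^ Cardinal.continuum.{u} ∧
        (∀ U : Set Y, IsOpen U → U.Nonempty →
          #U = (2 : Cardinal.{u}) ^ Cardinal.continuum.{u}) ∧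
        PerfectSpace Y) := by
  refine ⟨exists_separable_scattered_isSAU, fun X _ hSAU _ hX => ?_⟩
  have hopen := fun (U : Set (fullPoints X (2 ^ 𝔠))) (hU : IsOpen U) (hne : U.Nonempty) =>
    mk_isOpen_fullPoints hX hU hne
  have hSAU' := isSAU_fullPoints hX hSAU
  have : Nonempty (fullPoints X (2 ^ 𝔠)) := ⟨hSAU'.exists_nonisolated.choose⟩
  exact ⟨fullPoints X (2 ^ 𝔠), isClosed_fullPoints _, hSAU', dispersionCharacter_eq hopen, hopen,
    perfectSpace_fullPoints hX⟩
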